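/- For integers $a_1,a_2,\dots$ let $[0;a_1,a_2,\dots]$ denote the limit of the convergents of the infinite simple continued fraction $\cfrac{1}{a_1+\cfrac{1}{a_2+\cdots}}$, and write $[0;c,\overline{f_1(n),\dots,f_k(n)}]_{n=0}^{\infty}$ for $[0;c,f_1(0),\dots,f_k(0),f_1(1),\dots,f_k(1),f_1(2),\dots]$ (and similarly without $c$). For real $\nu>-1$ and $z>0$ let $$I_\nu(z)=\sum_{m=0}^{\infty}\frac{(z/2)^{\nu+2m}}{\Gamma(m+1)\,\Gamma(\nu+m+1)} .$$ Theorem. Let $a,b,p,u,v$ be integers with $b>0$, restricted, in the case of each continued fraction below, so that all its partial quotients (after the leading $0$) are positive. ($a$ and $b$ occur in (1) only.) Then each of the following continued fractions converges, and $$(1)\quad [0;\overline{p-1,1,u(a+2nb)-1,p-1,1,v(a+(2n+1)b)-1}]_{n=0}^{\infty}=\frac1p+\frac1p\sqrt{\frac vu}\;\frac{I_{a/b}\!\left(\frac{2}{bp\sqrt{uv}}\right)}{I_{a/b-1}\!\left(\frac{2}{bp\sqrt{uv}}\right)},$$ $$(2)\quad [0;p-1,\overline{1,(4n+1)u-1,p,(4n+3)v-1,1,p-2}]_{n=0}^{\infty}=\frac1p+\frac1p\sqrt{\frac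 vu}\,\tan\frac{1}{p\sqrt{uv}},$$ $$(3)\quad [0;\overline{p-1,1,(4n+1)u-1,p-1,1,(4n+3)v-1}]_{n=0}^{\infty}=\frac1p+\frac1p\sqrt{\frac vu}\,\tanh\frac{1}{p\sqrt{uv}},$$ $$(4)\quad [0;p-1,\overline{1,(4n+1)u-1,p-1,1,2v-1,p,(4n+3)u-1,1,p-1,2v-1,1,p-2}]_{n=0}^{\infty}=\frac1p+v\left(1-e^{-1/(up^2v)}\right).$$ -/

import Mathlib

open Filter Topology

/-- The modified Bessel function of the first kind,
`I_ν(z) = ∑_{m ≥ 0} (z/2)^(ν+2m) / (Γ(m+1) Γ(ν+m+1))`, for real order `ν` and real `z > 0`. -/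
noncomputable def besselI (ν z : ℝ) : ℝ :=
  ∑' m : ℕ, (z / 2) ^ (ν + 2 * (m : ℝ)) / (Real.Gamma (m + 1) * Real.Gamma (ν + m + 1))

/-- The sequence `f 0 0, …, f 0 (k-1), f 1 0, …, f 1 (k-1), f 2 0, …`, in which the block
`f n` of length `k` is written down for `n = 0, 1, 2, …` in turn. -/
def overlined {k : ℕ} [NeZero k] (f : ℕ → Fin k → ℤ) : Stream' ℤ :=
  fun i => f (i / k) (Fin.ofNat k i)

/-- The infinite simple continued fraction `[a₀; q 0, q 1, q 2, …]`, with all partial numerators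
equal to `1`. -/
noncomputable def simpleCF (a₀ : ℤ) (q : Stream' ℤ) : GenContFract ℝ :=
  ⟨(a₀ : ℝ), Stream'.Seq.ofStream (q.map fun c : ℤ => (⟨1, (c : ℝ)⟩ : GenContFract.Pair ℝ))⟩

/-- `HasValue a₀ q x` says that `[a₀; q 0, q 1, q 2, …] = x`: the convergents of the infinite
continued fraction converge to `x`. -/
def HasValue (a₀ : ℤ) (q : Stream' ℤ) (x : ℝ) : Prop :=
  Tendsto (fun n => (simpleCF a₀ q).convs n) atTop (𝓝 x)

/-! Positive reals `r i = 1 / (q i + r (i + 1))` with positive integers `q i` all lie below `1`, so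
the `q i` are the regular partial quotients of `r 0`, and convergence is that of the regular
expansion (`hasValue_of_tails`). It therefore suffices to exhibit positive tails, and only at the
starts of blocks (`exists_tails`).

The tails come from `besselSeries_sub_one`, which makes the ratio `R ν` of consecutive series
satisfy `R ν = 1 / (ν + y * R (ν + 1))`. After rescaling this is `T = 1 / (p * A + T')`, with `A` an
integer such as `u * (a + 2 * n * b)`. The value `(1 + T) / p` is made regular by removing minus
signs through `1 - x = 1 / (1 + 1 / (1 / x - 1))`, whence the quotients `p - 1, 1, A - 1`; the
`*_step_eval` lemmas do this algebra.

Order `1/2` gives `tanh` for `y > 0` and `tan` for `y < 0`. The exponential uses `1 - exp (-w) = 2 *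
t / (1 + t)` with `t = tanh (w / 2)`. For `y < 0` positivity is no longer termwise and is obtained
from explicit bounds on the series. -/

/-! ### Continued fractions with prescribed tails -/

/-- If `r i = 1 / (q i + r (i + 1))` with positive `r i` and positive integers `q i`, then
`[0; q 0, q 1, …] = r 0`. -/
theorem hasValue_of_tails (q : Stream' ℤ) (r : ℕ → ℝ) (hq : ∀ i, 0 < q.get i)
    (hr : ∀ i, 0 < r i) (h : ∀ i, r i = 1 / ((q.get i : ℝ) + r (i + 1))) :
    HasValue 0 q (r 0) := by
  have hq1 : ∀ i, (1 : ℝ) ≤ q.get i := fun i => by exact_mod_cast hq i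
  have hr1 : ∀ i, r i < 1 := fun i => by
    rw [h i, div_lt_one (by linarith [hq1 i, hr (i + 1)])]
    linarith [hq1 i, hr (i + 1)]
  -- Since `0 < r (i + 1) < 1`, the integer and fractional parts of `1 / r i` are `q i` and `r (i +
  -- 1)`: the regular algorithm applied to `r 0` reproduces `q`.
  have hof : ∀ i, GenContFract.IntFractPair.of (r i)⁻¹ = ⟨q.get i, r (i + 1)⟩ := fun i => by
    have hfl : ⌊(r i)⁻¹⌋ = q.get i := by
      rw [Int.floor_eq_iff, h i, one_div, inv_inv]
      constructor <;> linarith [hr (i + 1), hr1 (i + 1)]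
    have hfr : Int.fract (r i)⁻¹ = r (i + 1) := by
      rw [Int.fract, hfl, h i, one_div, inv_inv]; ring
    rw [GenContFract.IntFractPair.of, hfl, hfr]
  have hstream : ∀ n, GenContFract.IntFractPair.stream (r 0) (n + 1) =
      some ⟨q.get n, r (n + 1)⟩ := fun n => by
    induction n with
    | zero =>
      have hfr : (GenContFract.IntFractPair.of (r 0)).fr = r 0 :=
        Int.fract_eq_self.2 ⟨(hr 0).le, hr1 0⟩
      rw [GenContFract.IntFractPair.stream_succ_of_some
        (GenContFract.IntFractPair.stream_zero (r 0)) (by rw [hfr]; exact (hr 0).ne'), hfr, hof]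
    | succ n ih =>
      rw [GenContFract.IntFractPair.stream_succ_of_some ih (hr (n + 1)).ne', hof]
  have heq : simpleCF 0 q = GenContFract.of (r 0) := by
    refine GenContFract.ext ?_ (Stream'.Seq.ext fun n => ?_)
    · rw [GenContFract.of_h_eq_floor, Int.floor_eq_zero_iff.2 ⟨(hr 0).le, hr1 0⟩]
      rfl
    · rw [GenContFract.get?_of_eq_some_of_succ_get?_intFractPair_stream (hstream n)]
      rfl
  rw [HasValue, heq]
  exact GenContFract.of_convergence (r 0)

/-- The finite continued fraction `[0; c₁, …, c_k + y]`. -/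
noncomputable def blockEval (l : List ℝ) (y : ℝ) : ℝ :=
  l.foldr (fun c z => 1 / (c + z)) y

theorem blockEval_pos {l : List ℝ} {y : ℝ} (hl : ∀ c ∈ l, 0 < c) (hy : 0 < y) :
    0 < blockEval l y := by
  induction l with
  | nil => exact hy
  | cons c l ih =>
    have h₁ := hl c (by simp)
    have h₂ := ih fun d hd => hl d (by simp [hd])
    exact one_div_pos.2 (add_pos h₁ h₂)

theorem overlined_get {k : ℕ} [NeZero k] (f : ℕ → Fin k → ℤ) (n : ℕ) (j : Fin k) :
    (overlined f).get (k * n + j) = f n j := by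
  have hk : 0 < k := Nat.pos_of_ne_zero (NeZero.ne k)
  have h₁ : (k * n + j) / k = n := by
    rw [Nat.mul_add_div hk, Nat.div_eq_of_lt j.2, add_zero]
  have h₂ : Fin.ofNat k (k * n + j) = j := by
    ext
    simp [Fin.ofNat, Nat.mod_eq_of_lt j.2]
  change f ((k * n + j) / k) (Fin.ofNat k (k * n + j)) = _
  rw [h₁, h₂]

/-- Inside block `n` the tail at position `j` is found by evaluating the remaining entries of the
block at `X (n + 1)`, so one identity per block yields every tail. -/
theorem exists_tails {k : ℕ} [NeZero k] (f : ℕ → Fin k → ℤ) (X : ℕ → ℝ)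
    (hf : ∀ n j, 0 < f n j) (hX : ∀ n, 0 < X n)
    (h : ∀ n, X n = blockEval (List.ofFn fun j => (f n j : ℝ)) (X (n + 1))) :
    ∃ r : ℕ → ℝ, (∀ i, 0 < r i) ∧
      (∀ i, r i = 1 / (((overlined f).get i : ℝ) + r (i + 1))) ∧ r 0 = X 0 := by
  have hk : 0 < k := Nat.pos_of_ne_zero (NeZero.ne k)
  let R : ℕ → ℕ → ℝ := fun n j =>
    blockEval ((List.ofFn fun j => (f n j : ℝ)).drop j) (X (n + 1))
  have hR0 : ∀ n, R n 0 = X n := fun n => (h n).symm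
  have hRk : ∀ n, R n k = X (n + 1) := fun n => by
    simp only [R]
    rw [List.drop_eq_nil_of_le (by simp)]
    rfl
  have hRs : ∀ n j (hj : j < k), R n j = 1 / ((f n ⟨j, hj⟩ : ℝ) + R n (j + 1)) :=
    fun n j hj => by
      simp only [R]
      rw [List.drop_eq_getElem_cons (by simpa using hj), List.getElem_ofFn]
      rfl
  have hRp : ∀ n j, 0 < R n j := fun n j => by
    refine blockEval_pos (fun c hc => ?_) (hX _)
    obtain ⟨i, rfl⟩ := (List.mem_ofFn' _ _).1 (List.mem_of_mem_drop hc)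
    exact Int.cast_pos.2 (hf n i)
  refine ⟨fun i => R (i / k) (i % k), fun i => hRp _ _, fun i => ?_, ?_⟩
  · have hlt := Nat.mod_lt i hk
    have hget : (overlined f).get i = f (i / k) ⟨i % k, hlt⟩ := rfl
    -- At the end of a block the two descriptions agree, because `R n k = X (n + 1) = R (n + 1) 0`.
    have hnext : R ((i + 1) / k) ((i + 1) % k) = R (i / k) (i % k + 1) := by
      have hi := Nat.div_add_mod i k
      rcases Nat.lt_or_ge (i % k + 1) k with hc | hc
      · have e : i + 1 = k * (i / k) + (i % k + 1) := by omega
        have h₁ : (i + 1) / k = i / k := by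
          rw [e, Nat.mul_add_div hk, Nat.div_eq_of_lt hc, add_zero]
        have h₂ : (i + 1) % k = i % k + 1 := by
          conv_lhs => rw [e]
          rw [Nat.mul_add_mod, Nat.mod_eq_of_lt hc]
        rw [h₁, h₂]
      · have hc' : i % k + 1 = k := by omega
        have e : i + 1 = k * (i / k + 1) := by rw [mul_add]; omega
        have h₁ : (i + 1) / k = i / k + 1 := by rw [e, Nat.mul_div_cancel_left _ hk]
        have h₂ : (i + 1) % k = 0 := by rw [e, Nat.mul_mod_right]
        rw [h₁, h₂, hc', hR0, hRk]
    simp only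
    rw [hnext, hget, hRs _ _ hlt]
  · simp only [Nat.zero_div, Nat.zero_mod]
    exact hR0 0

theorem hasValue_overlined {k : ℕ} [NeZero k] (f : ℕ → Fin k → ℤ) (X : ℕ → ℝ)
    (hf : ∀ n j, 0 < f n j) (hX : ∀ n, 0 < X n)
    (h : ∀ n, X n = blockEval (List.ofFn fun j => (f n j : ℝ)) (X (n + 1))) :
    HasValue 0 (overlined f) (X 0) := by
  obtain ⟨r, hr, hrs, hr0⟩ := exists_tails f X hf hX h
  rw [← hr0]
  exact hasValue_of_tails _ r (fun i => hf _ _) hr hrs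

theorem hasValue_cons_overlined {k : ℕ} [NeZero k] (c : ℤ) (f : ℕ → Fin k → ℤ) (X : ℕ → ℝ)
    (hc : 0 < c) (hf : ∀ n j, 0 < f n j) (hX : ∀ n, 0 < X n)
    (h : ∀ n, X n = blockEval (List.ofFn fun j => (f n j : ℝ)) (X (n + 1))) :
    HasValue 0 (Stream'.cons c (overlined f)) (1 / ((c : ℝ) + X 0)) := by
  obtain ⟨r, hr, hrs, hr0⟩ := exists_tails f X hf hX h
  have hc' : (0 : ℝ) < c := by exact_mod_cast hc
  let r' : ℕ → ℝ := fun i => Nat.casesOn i (1 / ((c : ℝ) + r 0)) r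
  rw [← hr0]
  refine hasValue_of_tails (Stream'.cons c (overlined f)) r' (fun i => ?_) (fun i => ?_)
    fun i => ?_
  · cases i with
    | zero => exact hc
    | succ i => exact hf _ _
  · cases i with
    | zero => exact one_div_pos.2 (add_pos hc' (hr 0))
    | succ i => exact hr i
  · cases i with
    | zero => rfl
    | succ i => exact hrs i

/-! ### The hypergeometric series behind the Bessel functions -/

/-- `besselSeries ν y = ∑ yᵐ / (m! Γ(ν + m + 1))`, so that
`I_ν(z) = (z/2)^ν besselSeries ν (z²/4)`. -/
noncomputable def besselSeries (ν y : ℝ) : ℝ :=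
  ∑' m : ℕ, y ^ m / (m.factorial * Real.Gamma (ν + m + 1))

/-- The quotient of two consecutive `besselSeries`. -/
noncomputable def besselRatio (ν y : ℝ) : ℝ :=
  besselSeries ν y / besselSeries (ν - 1) y

/-- Each of the `m` factors that the functional equation of `Γ` produces is at least `ν + 1`. This
lets an exponential series dominate `besselSeries`. -/
theorem Gamma_mul_pow_le {ν : ℝ} (hν : -1 < ν) (m : ℕ) :
    Real.Gamma (ν + 1) * (ν + 1) ^ m ≤ Real.Gamma (ν + m + 1) := by
  have hpos : 0 < ν + 1 := by linarith
  induction m with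
  | zero => simp
  | succ m ih =>
    have hm : (0 : ℝ) ≤ m := m.cast_nonneg
    have e : ν + ((m + 1 : ℕ) : ℝ) + 1 = (ν + m + 1) + 1 := by push_cast; ring
    have hne : ν + m + 1 ≠ 0 := (by linarith : 0 < ν + m + 1).ne'
    rw [e, Real.Gamma_add_one hne, pow_succ]
    calc Real.Gamma (ν + 1) * ((ν + 1) ^ m * (ν + 1))
        = (ν + 1) * (Real.Gamma (ν + 1) * (ν + 1) ^ m) := by ring
      _ ≤ (ν + m + 1) * Real.Gamma (ν + m + 1) :=
        mul_le_mul (by linarith) ih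
          (mul_nonneg (Real.Gamma_pos_of_pos hpos).le (pow_nonneg hpos.le _)) (by linarith)

theorem abs_besselSeries_term_le {ν : ℝ} (hν : -1 < ν) (y : ℝ) (m : ℕ) :
    |y ^ m / (m.factorial * Real.Gamma (ν + m + 1))| ≤
      (|y| / (ν + 1)) ^ m / m.factorial / Real.Gamma (ν + 1) := by
  have hpos : 0 < ν + 1 := by linarith
  have hG := Real.Gamma_pos_of_pos hpos
  have hm : (0 : ℝ) < m.factorial := by exact_mod_cast m.factorial_pos
  have hle := Gamma_mul_pow_le hν m
  have hp : 0 < Real.Gamma (ν + 1) * (ν + 1) ^ m := mul_pos hG (pow_pos hpos m)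
  rw [abs_div, abs_pow, abs_of_pos (mul_pos hm (hp.trans_le hle)), div_pow, div_div, div_div]
  refine div_le_div_of_nonneg_left (pow_nonneg (abs_nonneg y) m) (by positivity) ?_
  calc (ν + 1) ^ m * (m.factorial * Real.Gamma (ν + 1))
      = m.factorial * (Real.Gamma (ν + 1) * (ν + 1) ^ m) := by ring
    _ ≤ _ := mul_le_mul_of_nonneg_left hle hm.le

theorem hasSum_pow_div_factorial (c : ℝ) :
    HasSum (fun m : ℕ => c ^ m / m.factorial) (Real.exp c) := by
  rw [Real.exp_eq_exp_ℝ]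
  exact NormedSpace.expSeries_div_hasSum_exp c

theorem summable_besselSeries {ν : ℝ} (hν : -1 < ν) (y : ℝ) :
    Summable fun m : ℕ => y ^ m / (m.factorial * Real.Gamma (ν + m + 1)) :=
  Summable.of_norm_bounded
    ((hasSum_pow_div_factorial (|y| / (ν + 1))).summable.div_const (Real.Gamma (ν + 1)))
    fun m => abs_besselSeries_term_le hν y m

theorem abs_besselSeries_sub_le {ν : ℝ} (hν : -1 < ν) (y : ℝ) :
    |besselSeries ν y - 1 / Real.Gamma (ν + 1)| ≤
      (Real.exp (|y| / (ν + 1)) - 1) / Real.Gamma (ν + 1) := by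
  have hE := (hasSum_pow_div_factorial (|y| / (ν + 1))).div_const (Real.Gamma (ν + 1))
  have hE' := (hasSum_nat_add_iff' 1).2 hE
  have hS := (hasSum_nat_add_iff' 1).2 (summable_besselSeries hν y).hasSum
  have := hS.norm_le_of_bounded hE' fun m => abs_besselSeries_term_le hν y (m + 1)
  simpa [besselSeries, sub_div] using this

theorem besselSeries_pos {ν y : ℝ} (hν : -1 < ν) (hy : 0 ≤ y) : 0 < besselSeries ν y := by
  have hG : ∀ m : ℕ, 0 < Real.Gamma (ν + m + 1) := fun m =>
    Real.Gamma_pos_of_pos (by linarith [(m.cast_nonneg : (0 : ℝ) ≤ m)])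
  refine (summable_besselSeries hν y).tsum_pos (fun m => ?_) 0 ?_
  · have := hG m
    positivity
  · have := hG 0
    simpa using this

/-- The terms after the first total at most `exp (1/4) - 1 ≤ 1/3` of it. Needed for negative `y`,
where the signs alternate. -/
theorem besselSeries_bounds {ν y : ℝ} (hν : -1 < ν) (hy : |y| ≤ (ν + 1) / 4) :
    2 / 3 / Real.Gamma (ν + 1) ≤ besselSeries ν y ∧
      besselSeries ν y ≤ 4 / 3 / Real.Gamma (ν + 1) := by
  have hpos : 0 < ν + 1 := by linarith
  have hG := Real.Gamma_pos_of_pos hpos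
  have hc : |y| / (ν + 1) ≤ 1 / 4 := by
    rw [div_le_iff₀ hpos]; linarith
  have hexp : Real.exp (|y| / (ν + 1)) ≤ 4 / 3 := by
    refine (Real.exp_le_exp.2 hc).trans ?_
    -- Inverting `3/4 ≤ exp (-1/4)` gives the constant `4/3`.
    have h := Real.one_sub_le_exp_neg (1 / 4)
    rw [Real.exp_neg] at h
    have := inv_anti₀ (by norm_num) h
    rw [inv_inv] at this
    linarith
  have h := abs_le.1 ((abs_besselSeries_sub_le hν y).trans
    (div_le_div_of_nonneg_right (show _ ≤ (1 / 3 : ℝ) by linarith) hG.le))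
  have e₁ : 2 / 3 / Real.Gamma (ν + 1) = 1 / Real.Gamma (ν + 1) - 1 / 3 / Real.Gamma (ν + 1) := by
    ring
  have e₂ : 4 / 3 / Real.Gamma (ν + 1) = 1 / Real.Gamma (ν + 1) + 1 / 3 / Real.Gamma (ν + 1) := by
    ring
  constructor <;> linarith [h.1, h.2]

/-- Termwise, `Γ (ν + m + 2) = (ν + (m + 1)) * Γ (ν + m + 1)`: the summand `ν` gives the first
series, and `m + 1` cancels against `(m + 1)!` to give the second, shifted by one. -/
theorem besselSeries_sub_one {ν : ℝ} (hν : 0 < ν) (y : ℝ) :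
    besselSeries (ν - 1) y = ν * besselSeries ν y + y * besselSeries (ν + 1) y := by
  have h₀ := (summable_besselSeries (show -1 < ν - 1 by linarith) y)
  have h₁ := (summable_besselSeries (show -1 < ν by linarith) y)
  simp only [besselSeries]
  rw [h₀.tsum_eq_zero_add, h₁.tsum_eq_zero_add, mul_add, add_assoc (ν * _)]
  congr 1
  · have hG := (Real.Gamma_pos_of_pos hν).ne'
    simp only [CharP.cast_eq_zero, pow_zero, Nat.factorial_zero, Nat.cast_one, one_mul, add_zero,
      sub_add_cancel]
    rw [Real.Gamma_add_one hν.ne']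
    field_simp
  · rw [← tsum_mul_left, ← tsum_mul_left, ← Summable.tsum_add]
    · refine tsum_congr fun m => ?_
      have hm : (0 : ℝ) ≤ m := m.cast_nonneg
      have hpos : 0 < ν + m + 1 := by linarith
      have hG := (Real.Gamma_pos_of_pos hpos).ne'
      have e₁ : ν - 1 + ((m + 1 : ℕ) : ℝ) + 1 = ν + m + 1 := by push_cast; ring
      have e₂ : ν + ((m + 1 : ℕ) : ℝ) + 1 = ν + m + 1 + 1 := by push_cast; ring
      have e₃ : ν + 1 + (m : ℝ) + 1 = ν + m + 1 + 1 := by ring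
      have hf : (m.factorial : ℝ) ≠ 0 := by exact_mod_cast m.factorial_ne_zero
      have hm1 : (m : ℝ) + 1 ≠ 0 := by linarith
      rw [e₁, e₂, e₃, Real.Gamma_add_one hpos.ne', Nat.factorial_succ]
      push_cast
      field_simp
      ring
    · exact ((summable_nat_add_iff 1).2 h₁).mul_left ν
    · exact (summable_besselSeries (show -1 < ν + 1 by linarith) y).mul_left y

theorem besselRatio_mul {ν y : ℝ} (hν : 0 < ν) (h₀ : besselSeries (ν - 1) y ≠ 0)
    (h₁ : besselSeries ν y ≠ 0) :
    besselRatio ν y * (ν + y * besselRatio (ν + 1) y) = 1 := by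
  rw [besselRatio, besselRatio, add_sub_cancel_right]
  have h := besselSeries_sub_one hν y
  field_simp
  linarith

theorem besselRatio_pos {ν y : ℝ} (hν : 0 < ν) (hy : 0 ≤ y) : 0 < besselRatio ν y :=
  div_pos (besselSeries_pos (by linarith) hy) (besselSeries_pos (by linarith) hy)

theorem besselRatio_mul_of_nonneg {ν y : ℝ} (hν : 0 < ν) (hy : 0 ≤ y) :
    besselRatio ν y * (ν + y * besselRatio (ν + 1) y) = 1 :=
  besselRatio_mul hν (besselSeries_pos (by linarith) hy).ne'
    (besselSeries_pos (by linarith) hy).ne'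

theorem besselSeries_pos_of_abs_le {ν y : ℝ} (hν : -1 < ν) (hy : |y| ≤ (ν + 1) / 4) :
    0 < besselSeries ν y :=
  (div_pos (by norm_num) (Real.Gamma_pos_of_pos (by linarith))).trans_le
    (besselSeries_bounds hν hy).1

theorem besselRatio_pos_of_abs_le {ν y : ℝ} (hν : 0 < ν) (hy : |y| ≤ ν / 4) :
    0 < besselRatio ν y :=
  div_pos (besselSeries_pos_of_abs_le (by linarith) (by linarith))
    (besselSeries_pos_of_abs_le (by linarith) (by linarith))

theorem besselRatio_mul_of_abs_le {ν y : ℝ} (hν : 0 < ν) (hy : |y| ≤ ν / 4) :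
    besselRatio ν y * (ν + y * besselRatio (ν + 1) y) = 1 :=
  besselRatio_mul hν (besselSeries_pos_of_abs_le (by linarith) (by linarith)).ne'
    (besselSeries_pos_of_abs_le (by linarith) (by linarith)).ne'

theorem besselRatio_le {ν y : ℝ} (hν : 0 < ν) (hy : |y| ≤ ν / 4) :
    besselRatio ν y ≤ 2 / ν := by
  have h₁ := (besselSeries_bounds (show -1 < ν by linarith) (by linarith : |y| ≤ (ν + 1) / 4)).2
  have h₀ := (besselSeries_bounds (show -1 < ν - 1 by linarith)
    (by linarith : |y| ≤ (ν - 1 + 1) / 4)).1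
  have hG := Real.Gamma_pos_of_pos hν
  rw [sub_add_cancel] at h₀
  rw [Real.Gamma_add_one hν.ne'] at h₁
  have hpos : 0 < 2 / 3 / Real.Gamma ν := by positivity
  rw [besselRatio]
  refine (div_le_div₀ (by positivity) h₁ hpos h₀).trans (le_of_eq ?_)
  field_simp
  norm_num

theorem besselI_eq (ν : ℝ) {z : ℝ} (hz : 0 < z) :
    besselI ν z = (z / 2) ^ ν * besselSeries ν (z ^ 2 / 4) := by
  rw [besselI, besselSeries, ← tsum_mul_left]
  refine tsum_congr fun m => ?_
  have e : (z / 2) ^ (2 * (m : ℝ)) = (z ^ 2 / 4) ^ m := by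
    rw [show 2 * (m : ℝ) = ((2 * m : ℕ) : ℝ) by push_cast; ring, Real.rpow_natCast, pow_mul]
    congr 1
    ring
  rw [Real.rpow_add (by positivity), e, Real.Gamma_nat_eq_factorial]
  ring

theorem besselI_div_besselI (ν : ℝ) {z : ℝ} (hz : 0 < z) :
    besselI ν z / besselI (ν - 1) z = z / 2 * besselRatio ν (z ^ 2 / 4) := by
  have hz2 : 0 < z / 2 := by positivity
  rw [besselI_eq ν hz, besselI_eq (ν - 1) hz, besselRatio, Real.rpow_sub_one hz2.ne']
  have := (Real.rpow_pos_of_pos hz2 ν).ne'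
  field_simp

/-- The duplication formula at half-integers: it turns the series of order `-1/2` into that of
`cosh` or `cos`, up to a factor that cancels in `besselRatio`. -/
theorem factorial_mul_Gamma_add_half (m : ℕ) :
    (m.factorial : ℝ) * Real.Gamma (1 / 2 - 1 + m + 1) * 4 ^ m =
      (2 * m).factorial * Real.Gamma (1 / 2) := by
  induction m with
  | zero => norm_num
  | succ m ih =>
    have e₀ : (1 / 2 - 1 + m + 1 : ℝ) = m + 1 / 2 := by ring
    have e : (1 / 2 - 1 + ((m + 1 : ℕ) : ℝ) + 1) = m + 1 / 2 + 1 := by push_cast; ring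
    have e₂ : 2 * (m + 1) = 2 * m + 1 + 1 := by ring
    rw [e₀] at ih
    rw [e, Real.Gamma_add_one (by positivity), Nat.factorial_succ, e₂, Nat.factorial_succ,
      Nat.factorial_succ, pow_succ]
    push_cast
    linear_combination (2 * (m + 1) * (2 * m + 1) : ℝ) * ih

theorem factorial_mul_Gamma_add_three_halves (m : ℕ) :
    (m.factorial : ℝ) * Real.Gamma (1 / 2 + m + 1) * 4 ^ m * 2 =
      (2 * m + 1).factorial * Real.Gamma (1 / 2) := by
  have h := factorial_mul_Gamma_add_half m
  have e₀ : (1 / 2 - 1 + m + 1 : ℝ) = m + 1 / 2 := by ring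
  have e : (1 / 2 + m + 1 : ℝ) = m + 1 / 2 + 1 := by ring
  rw [e₀] at h
  rw [e, Real.Gamma_add_one (by positivity), Nat.factorial_succ]
  push_cast
  linear_combination (2 * m + 1 : ℝ) * h

theorem besselSeries_half_sub_one (y : ℝ) :
    besselSeries (1 / 2 - 1) y = (∑' m : ℕ, (4 * y) ^ m / (2 * m).factorial) /
      Real.Gamma (1 / 2) := by
  rw [besselSeries, ← tsum_div_const]
  refine tsum_congr fun m => ?_
  have h := factorial_mul_Gamma_add_half m
  have h₁ : ((2 * m).factorial : ℝ) ≠ 0 := by exact_mod_cast Nat.factorial_ne_zero _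
  have h₂ : (m.factorial : ℝ) ≠ 0 := by exact_mod_cast Nat.factorial_ne_zero _
  have h₃ : Real.Gamma (1 / 2) ≠ 0 := (Real.Gamma_pos_of_pos (by norm_num)).ne'
  have h₄ : Real.Gamma (1 / 2 - 1 + m + 1) ≠ 0 :=
    (Real.Gamma_pos_of_pos (by linarith [(m.cast_nonneg : (0 : ℝ) ≤ m)])).ne'
  rw [mul_pow, div_div, div_eq_div_iff (mul_ne_zero h₂ h₄) (mul_ne_zero h₁ h₃)]
  linear_combination (-y ^ m) * h

theorem besselSeries_half (y : ℝ) :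
    besselSeries (1 / 2) y = 2 * (∑' m : ℕ, (4 * y) ^ m / (2 * m + 1).factorial) /
      Real.Gamma (1 / 2) := by
  rw [besselSeries, ← tsum_mul_left, ← tsum_div_const]
  refine tsum_congr fun m => ?_
  have h := factorial_mul_Gamma_add_three_halves m
  have h₁ : ((2 * m + 1).factorial : ℝ) ≠ 0 := by exact_mod_cast Nat.factorial_ne_zero _
  have h₂ : (m.factorial : ℝ) ≠ 0 := by exact_mod_cast Nat.factorial_ne_zero _
  have h₃ : Real.Gamma (1 / 2) ≠ 0 := (Real.Gamma_pos_of_pos (by norm_num)).ne'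
  have h₄ : Real.Gamma (1 / 2 + m + 1) ≠ 0 :=
    (Real.Gamma_pos_of_pos (by linarith [(m.cast_nonneg : (0 : ℝ) ≤ m)])).ne'
  rw [mul_pow, ← mul_div_assoc, div_div, div_eq_div_iff (mul_ne_zero h₂ h₄) (mul_ne_zero h₁ h₃)]
  linear_combination (-y ^ m) * h

theorem besselRatio_half (y : ℝ) :
    besselRatio (1 / 2) y = 2 * (∑' m : ℕ, (4 * y) ^ m / (2 * m + 1).factorial) /
      ∑' m : ℕ, (4 * y) ^ m / (2 * m).factorial := by
  have h₃ : Real.Gamma (1 / 2) ≠ 0 := (Real.Gamma_pos_of_pos (by norm_num)).ne'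
  rw [besselRatio, besselSeries_half, besselSeries_half_sub_one, div_div_div_cancel_right₀ h₃]

theorem tanh_eq_besselRatio (z : ℝ) :
    Real.tanh z = z / 2 * besselRatio (1 / 2) (z ^ 2 / 4) := by
  have h₁ : Real.sinh z = z * ∑' m : ℕ, (4 * (z ^ 2 / 4)) ^ m / (2 * m + 1).factorial := by
    rw [← (Real.hasSum_sinh z).tsum_eq, ← tsum_mul_left]
    refine tsum_congr fun m => ?_
    rw [mul_div_cancel₀ _ (by norm_num : (4 : ℝ) ≠ 0), ← pow_mul, pow_succ]
    ring
  have h₂ : Real.cosh z = ∑' m : ℕ, (4 * (z ^ 2 / 4)) ^ m / (2 * m).factorial := by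
    rw [← (Real.hasSum_cosh z).tsum_eq]
    refine tsum_congr fun m => ?_
    rw [mul_div_cancel₀ _ (by norm_num : (4 : ℝ) ≠ 0), ← pow_mul]
  rw [besselRatio_half, Real.tanh_eq_sinh_div_cosh, h₁, h₂]
  ring

/-- No restriction on `z` is needed: at a zero of `cos` both sides are divisions by zero. -/
theorem tan_eq_besselRatio (z : ℝ) :
    Real.tan z = z / 2 * besselRatio (1 / 2) (-(z ^ 2 / 4)) := by
  have e : 4 * -(z ^ 2 / 4) = -1 * z ^ 2 := by ring
  have h₁ : Real.sin z = z * ∑' m : ℕ, (4 * -(z ^ 2 / 4)) ^ m / (2 * m + 1).factorial := by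
    rw [← (Real.hasSum_sin z).tsum_eq, ← tsum_mul_left]
    refine tsum_congr fun m => ?_
    rw [e, mul_pow, ← pow_mul, pow_succ z]
    ring
  have h₂ : Real.cos z = ∑' m : ℕ, (4 * -(z ^ 2 / 4)) ^ m / (2 * m).factorial := by
    rw [← (Real.hasSum_cos z).tsum_eq]
    refine tsum_congr fun m => ?_
    rw [e, mul_pow, ← pow_mul]
  rw [besselRatio_half, Real.tan_eq_sin_div_cos, h₁, h₂]
  ring

theorem one_sub_exp_neg_eq_tanh (w : ℝ) :
    1 - Real.exp (-w) = 2 * Real.tanh (w / 2) / (1 + Real.tanh (w / 2)) := by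
  have e : Real.exp (-w) = Real.exp (-(w / 2)) * Real.exp (-(w / 2)) := by
    rw [← Real.exp_add]; congr 1; ring
  have hm : Real.exp (w / 2) * Real.exp (-(w / 2)) = 1 := by
    rw [← Real.exp_add, add_neg_cancel, Real.exp_zero]
  have h₁ := Real.exp_pos (w / 2)
  have h₂ := Real.exp_pos (-(w / 2))
  have hs : Real.exp (w / 2) + Real.exp (-(w / 2)) ≠ 0 := (add_pos h₁ h₂).ne'
  rw [Real.tanh_eq, e]
  have h3 : 1 + (Real.exp (w / 2) - Real.exp (-(w / 2))) /
      (Real.exp (w / 2) + Real.exp (-(w / 2))) =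
      2 * Real.exp (w / 2) / (Real.exp (w / 2) + Real.exp (-(w / 2))) := by
    field_simp; ring
  rw [h3, ← mul_div_assoc, div_div_div_cancel_right₀ hs, eq_div_iff (by positivity)]
  linear_combination (-2 * Real.exp (-(w / 2))) * hm

/-! ### Evaluation of the blocks -/

theorem forall_pos_of_overlined {k : ℕ} [NeZero k] {f : ℕ → Fin k → ℤ}
    (h : ∀ i, 0 < (overlined f).get i) (n : ℕ) (j : Fin k) : 0 < f n j := by
  rw [← overlined_get f n j]
  exact h _

theorem forall_pos_of_cons_overlined {k : ℕ} [NeZero k] {c : ℤ} {f : ℕ → Fin k → ℤ}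
    (h : ∀ i, 0 < (Stream'.cons c (overlined f)).get i) : 0 < c ∧ ∀ n j, 0 < f n j :=
  ⟨h 0, forall_pos_of_overlined fun i => h (i + 1)⟩

/-- Here `p / (1 + T) = p - x` with `1 / x = A + (1 + T') / p`, and `1 - x = 1 / (1 + 1 / (1 / x -
1))`. The right side is the tail of `(1 + T) / p` after its first quotient `p - 1`. -/
theorem two_step_eval {p A T T' : ℝ} (hp1 : 1 < p) (hA : 0 < A - 1) (hT' : 0 < 1 + T')
    (h : T * (p * A + T') = 1) :
    1 / (1 + 1 / (A - 1 + (1 + T') / p)) = p / (1 + T) - (p - 1) := by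
  have hp : 0 < p := by linarith
  have hS : 0 < p * A + T' := by nlinarith
  have hT : T = 1 / (p * A + T') := by rw [eq_div_iff hS.ne', h]
  have h₁ : 0 < A - 1 + (1 + T') / p := by positivity
  have e : A - 1 + (1 + T') / p = (p * A + T' + 1 - p) / p := by field_simp; ring
  rw [e] at h₁ ⊢
  have h₂ : 0 < p * A + T' + 1 - p := by
    have := mul_pos h₁ hp
    rwa [div_mul_cancel₀ _ hp.ne'] at this
  have h₃ : 1 + p / (p * A + T' + 1 - p) = (p * A + T' + 1) / (p * A + T' + 1 - p) := by
    rw [eq_div_iff h₂.ne', add_mul, div_mul_cancel₀ _ h₂.ne']; ring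
  have h₄ : 1 + 1 / (p * A + T') = (p * A + T' + 1) / (p * A + T') := by
    rw [eq_div_iff hS.ne', add_mul, div_mul_cancel₀ _ hS.ne']; ring
  rw [hT, h₄, one_div_div, h₃, one_div_div, div_div_eq_mul_div, eq_sub_iff_add_eq,
    div_add' _ _ _ (by linarith : p * A + T' + 1 ≠ 0)]
  congr 1
  ring

theorem three_step_eval {p A T T' : ℝ} (hp : 1 < p) (hA : 0 < A - 1) (hT' : 0 < 1 + T')
    (h : T * (p * A + T') = 1) :
    1 / (p - 1 + 1 / (1 + 1 / (A - 1 + (1 + T') / p))) = (1 + T) / p := by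
  rw [two_step_eval hp hA hT' h, add_sub_cancel, one_div_div]

/-- Now `T < 0`, and `p / (1 + T) = p + 1 / (B - x)` with `x = (1 + T') / p`. Writing `B - x = B - 1
+ (1 - x)` leaves `1 / x - 1`, which is `p - 2` plus the tail of `x` after its quotient `p - 1`. -/
theorem four_step_eval {p B T T' : ℝ} (hp : 0 < p) (hT'0 : 0 < 1 + T') (hT' : T' < p - 1)
    (hB : 0 < p * B - T' - 1) (h : T * (p * B - T') = -1) :
    1 / (p + 1 / (B - 1 + 1 / (1 + 1 / (p - 2 + (p / (1 + T') - (p - 1)))))) = (1 + T) / p := by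
  have h0 : 0 < p - 1 - T' := by linarith
  have e₁ : p - 2 + (p / (1 + T') - (p - 1)) = (p - 1 - T') / (1 + T') := by
    field_simp; ring
  have e₂ : 1 + (1 + T') / (p - 1 - T') = p / (p - 1 - T') := by
    rw [eq_div_iff h0.ne', add_mul, div_mul_cancel₀ _ h0.ne']; ring
  have e₃ : B - 1 + (p - 1 - T') / p = (p * B - T' - 1) / p := by field_simp; ring
  have e₄ : p + p / (p * B - T' - 1) = p * (p * B - T') / (p * B - T' - 1) := by
    rw [eq_div_iff hB.ne', add_mul, div_mul_cancel₀ _ hB.ne']; ring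
  have hM : 0 < p * B - T' := by linarith
  have hT : T = -1 / (p * B - T') := by rw [eq_div_iff hM.ne', h]
  rw [e₁, one_div_div, e₂, one_div_div, e₃, one_div_div, e₄, one_div_div, hT]
  field_simp
  ring

/-- The sign removal of `four_step_eval` performed twice: with `M = 2 * p * V - T'`, the quantity `2
* p * V * s / (1 + s)` equals `1 / (p * C + 1 / M)`. -/
theorem seven_step_eval {p C V s t : ℝ} (hp : 2 < p) (hC : 1 ≤ C) (hV : 1 ≤ V) (hs : 0 < s)
    (ht : 0 < t) (hVt : 2 * p * V * t < 1) (h : s * (2 * p * C * (p * V) + t) = 1) :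
    1 / (p + 1 / (C - 1 + 1 / (1 + 1 / (p - 1 + 1 / (2 * V - 1 + 1 / (1 + 1 / (p - 2 +
      (p / (1 + 2 * p * V * t / (1 + t)) - (p - 1))))))))) =
      (1 + -(2 * p * V * s / (1 + s))) / p := by
  have hp0 : 0 < p := by linarith
  have hpV : 2 < p * V := by nlinarith
  have hpC : 2 < p * C := by nlinarith
  have ht1 : 0 < 1 + t := by linarith
  have hs1 : 0 < 1 + s := by linarith
  have hVt0 : 0 < 2 * p * V * t := by positivity
  set T' := 2 * p * V * t / (1 + t) with hT'
  have hT'0 : 0 < T' := by positivity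
  have hT'1 : T' < 1 := by
    rw [hT', div_lt_one ht1]; linarith
  set M := 2 * p * V - T' with hM
  have hM1 : 0 < M - 1 := by rw [hM]; nlinarith
  have hM0 : 0 < M := by linarith
  have hMt : M * (1 + t) = 2 * p * V := by
    rw [hM, hT', sub_mul, div_mul_cancel₀ _ ht1.ne']; ring
  have h0 : 0 < p - 1 - T' := by linarith
  have e₁ : p - 2 + (p / (1 + T') - (p - 1)) = (p - 1 - T') / (1 + T') := by
    field_simp; ring
  have e₂ : 1 + (1 + T') / (p - 1 - T') = p / (p - 1 - T') := by
    rw [eq_div_iff h0.ne', add_mul, div_mul_cancel₀ _ h0.ne']; ring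
  have e₃ : 2 * V - 1 + (p - 1 - T') / p = (M - 1) / p := by rw [hM]; field_simp; ring
  have hN : 0 < p * M - (M - 1) := by nlinarith
  have e₄ : p - 1 + p / (M - 1) = (p * M - (M - 1)) / (M - 1) := by
    field_simp; ring
  have e₅ : 1 + (M - 1) / (p * M - (M - 1)) = p * M / (p * M - (M - 1)) := by
    rw [eq_div_iff hN.ne', add_mul, div_mul_cancel₀ _ hN.ne']; ring
  have e₆ : C - 1 + (p * M - (M - 1)) / (p * M) = (p * C * M - M + 1) / (p * M) := by
    field_simp; ring
  have hK : 0 < p * C * M - M + 1 := by nlinarith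
  have e₇ : p + p * M / (p * C * M - M + 1) =
      p * (p * C * M + 1) / (p * C * M - M + 1) := by
    rw [eq_div_iff hK.ne', add_mul, div_mul_cancel₀ _ hK.ne']; ring
  rw [e₁, one_div_div, e₂, one_div_div, e₃, one_div_div, e₄, one_div_div, e₅, one_div_div, e₆,
    one_div_div, e₇, one_div_div]
  have hL : 0 < p * C * M + 1 := by nlinarith
  have key : 2 * p * V * s / (1 + s) = M / (p * C * M + 1) := by
    rw [div_eq_div_iff hs1.ne' hL.ne', ← hMt]
    linear_combination M * h + M * s * p * C * hMt
  rw [key]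
  field_simp
  ring

/-! ### The continued fractions -/

theorem hasValue_besselRatio {a b p u v : ℤ} (hb : 0 < b)
    (hq : ∀ i, 0 < (overlined fun n : ℕ =>
      ![p - 1, 1, u * (a + 2 * n * b) - 1, p - 1, 1, v * (a + (2 * n + 1) * b) - 1]).get i) :
    1 < p ∧ 0 < u ∧ 0 < v ∧ HasValue 0 (overlined fun n : ℕ =>
      ![p - 1, 1, u * (a + 2 * n * b) - 1, p - 1, 1, v * (a + (2 * n + 1) * b) - 1])
      ((1 + besselRatio ((a : ℝ) / b) (1 / ((b : ℝ) ^ 2 * p ^ 2 * u * v)) / (b * p * u)) / p) := by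
  have hf := forall_pos_of_overlined hq
  have hp : 1 < p := by have := hf 0 0; simp at this; linarith
  have hA : ∀ n : ℕ, 1 < u * (a + 2 * n * b) := fun n => by
    have := hf n 2; simp at this; linarith
  have hB : ∀ n : ℕ, 1 < v * (a + (2 * n + 1) * b) := fun n => by
    have := hf n 5; simp at this; linarith
  have hu : 0 < u := by
    by_contra hu
    -- At `n = |a|` the factor `a + 2 * n * b` is nonnegative because `b ≥ 1`, so `u ≤ 0` would make
    -- the product nonpositive.
    have h := hA a.natAbs
    have : 0 ≤ a + 2 * (a.natAbs : ℤ) * b := by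
      rw [Int.natCast_natAbs]
      nlinarith [neg_abs_le a, abs_nonneg a]
    nlinarith
  have ha : 0 < a := by
    have := hA 0
    simp at this
    exact pos_of_mul_pos_right (by linarith) hu.le
  have hv : 0 < v := by
    have := hB 0
    simp at this
    by_contra hv
    nlinarith
  refine ⟨hp, hu, hv, ?_⟩
  have hb' : (0 : ℝ) < b := by exact_mod_cast hb
  have hp' : (1 : ℝ) < p := by exact_mod_cast hp
  have hp0 : (0 : ℝ) < p := by linarith
  have hu' : (0 : ℝ) < u := by exact_mod_cast hu
  have hv' : (0 : ℝ) < v := by exact_mod_cast hv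
  have ha' : (0 : ℝ) < a := by exact_mod_cast ha
  set y : ℝ := 1 / ((b : ℝ) ^ 2 * p ^ 2 * u * v) with hy
  have hy0 : 0 ≤ y := by positivity
  set ρ : ℕ → ℝ := fun k => besselRatio ((a : ℝ) / b + k) y with hρ
  have hν : ∀ k : ℕ, 0 < (a : ℝ) / b + k := fun k => by positivity
  have hρ0 : ∀ k, 0 < ρ k := fun k => besselRatio_pos (hν k) hy0
  have hρs : ∀ k, ρ k * ((a : ℝ) / b + k + y * ρ (k + 1)) = 1 := fun k => by
    have := besselRatio_mul_of_nonneg (hν k) hy0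
    simpa [hρ, add_assoc] using this
  have hX := hasValue_overlined _ (fun n => (1 + ρ (2 * n) / (b * p * u)) / p) hf
    (fun n => by have := hρ0 (2 * n); positivity) (fun n => by
      have hA' : (0 : ℝ) < u * (a + 2 * n * b) - 1 := by
        have := hA n
        have : (1 : ℝ) < u * (a + 2 * n * b) := by exact_mod_cast this
        linarith
      have hB' : (0 : ℝ) < v * (a + (2 * n + 1) * b) - 1 := by
        have := hB n
        have : (1 : ℝ) < v * (a + (2 * n + 1) * b) := by exact_mod_cast this
        linarith
      have h₀ := hρ0 (2 * n + 1)
      have h₁ := hρ0 (2 * (n + 1))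
      simp only [blockEval, List.ofFn_succ, List.ofFn_zero, List.foldr_cons, List.foldr_nil]
      simp only [Matrix.cons_val, Fin.succ_zero_eq_one, Fin.succ_one_eq_two]
      push_cast
      have r₁ := hρs (2 * n)
      have r₂ := hρs (2 * n + 1)
      rw [show 2 * n + 1 + 1 = 2 * (n + 1) by ring] at r₂
      push_cast at r₁ r₂
      rw [three_step_eval (T := ρ (2 * n + 1) / (b * p * v)) hp' hB' (by positivity) ?_,
        three_step_eval (T := ρ (2 * n) / (b * p * u)) hp' hA' (by positivity) ?_]
      · refine Eq.trans ?_ r₁; rw [hy]; field_simp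
      · refine Eq.trans ?_ r₂; rw [hy]; field_simp)
  simpa [hρ] using hX

theorem hasValue_besselRatio_neg {p u v : ℤ}
    (hq : ∀ i, 0 < (Stream'.cons (p - 1) (overlined fun n : ℕ =>
      ![1, (4 * n + 1) * u - 1, p, (4 * n + 3) * v - 1, 1, p - 2])).get i) :
    2 < p ∧ 1 < u ∧ 0 < v ∧ HasValue 0 (Stream'.cons (p - 1) (overlined fun n : ℕ =>
      ![1, (4 * n + 1) * u - 1, p, (4 * n + 3) * v - 1, 1, p - 2]))
      ((1 + besselRatio (1 / 2) (-(1 / (4 * (p : ℝ) ^ 2 * u * v))) / (2 * p * u)) / p) := by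
  obtain ⟨hc, hf⟩ := forall_pos_of_cons_overlined hq
  have hp : 2 < p := by have := hf 0 5; simp at this; linarith
  have hu : 1 < u := by have := hf 0 1; simp at this; linarith
  have hv : 0 < v := by have := hf 0 3; simp at this; linarith
  refine ⟨hp, hu, hv, ?_⟩
  have hp' : (3 : ℝ) ≤ p := by exact_mod_cast hp
  have hp0 : (0 : ℝ) < p := by linarith
  have hu' : (2 : ℝ) ≤ u := by exact_mod_cast hu
  have hv' : (1 : ℝ) ≤ v := by exact_mod_cast hv
  have hu0 : (0 : ℝ) < u := by linarith
  have hv0 : (0 : ℝ) < v := by linarith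
  have hpu : (6 : ℝ) ≤ p * u := by nlinarith
  have hpv : (3 : ℝ) ≤ p * v := by nlinarith
  set y : ℝ := -(1 / (4 * (p : ℝ) ^ 2 * u * v)) with hy
  -- `1/8` is a quarter of the least order `1/2`, so the bounds for negative argument apply to every
  -- `ρ k`.
  have hy8 : |y| ≤ 1 / 8 := by
    rw [hy, abs_neg, abs_of_pos (by positivity)]
    refine one_div_le_one_div_of_le (by norm_num) ?_
    nlinarith [mul_le_mul hpu hpv (by norm_num) (by positivity)]
  set ρ : ℕ → ℝ := fun k => besselRatio (1 / 2 + k) y with hρ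
  have hν : ∀ k : ℕ, (1 / 2 : ℝ) ≤ 1 / 2 + k := fun k => by simp
  have hyν : ∀ k : ℕ, |y| ≤ (1 / 2 + k : ℝ) / 4 := fun k => by linarith [hν k]
  have hρ0 : ∀ k, 0 < ρ k := fun k =>
    besselRatio_pos_of_abs_le (by linarith [hν k]) (hyν k)
  have hρ4 : ∀ k, ρ k ≤ 4 := fun k => by
    refine (besselRatio_le (by linarith [hν k]) (hyν k)).trans ?_
    rw [div_le_iff₀ (by linarith [hν k])]
    linarith [hν k]
  have hρs : ∀ k, ρ k * ((1 / 2 : ℝ) + k + y * ρ (k + 1)) = 1 := fun k => by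
    have := besselRatio_mul_of_abs_le (by linarith [hν k]) (hyν k)
    simpa [hρ, add_assoc] using this
  set T : ℕ → ℝ := fun n => ρ (2 * n) / (2 * p * u) with hT
  have hT0 : ∀ n, 0 < T n := fun n => by
    have := hρ0 (2 * n); simp only [hT]; positivity
  have hT1 : ∀ n, T n ≤ 1 / 3 := fun n => by
    simp only [hT]
    rw [div_le_iff₀ (by positivity)]
    linarith [hρ4 (2 * n)]
  set S : ℕ → ℝ := fun n => -(ρ (2 * n + 1) / (2 * p * v)) with hS
  have hS1 : ∀ n, 0 < 1 + S n := fun n => by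
    have : ρ (2 * n + 1) / (2 * p * v) < 1 := by
      rw [div_lt_one (by positivity)]
      linarith [hρ4 (2 * n + 1)]
    simp only [hS]
    linarith
  have hTS : ∀ n : ℕ, T n * (p * ((4 * n + 1) * u) + S n) = 1 := fun n => by
    have r := hρs (2 * n)
    push_cast at r
    refine Eq.trans ?_ r
    rw [hy, hT, hS]
    field_simp
    ring
  have hST : ∀ n : ℕ, S n * (p * ((4 * n + 3) * v) - T (n + 1)) = -1 := fun n => by
    have r := hρs (2 * n + 1)
    rw [show 2 * n + 1 + 1 = 2 * (n + 1) by ring] at r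
    push_cast at r
    refine Eq.trans ?_ (congrArg Neg.neg r)
    rw [hy, hT, hS]
    field_simp
    ring
  have hX := hasValue_cons_overlined (p - 1) _ (fun n => p / (1 + T n) - (p - 1)) hc hf
    (fun n => by
      have h1 := hTS n
      have h2 := hT0 n
      have h3 := hS1 n
      have hn : (0 : ℝ) ≤ n := n.cast_nonneg
      have : (p : ℝ) - 1 < p * ((4 * n + 1) * u) + S n := by
        have : (1 : ℝ) ≤ (4 * n + 1) * u := by nlinarith
        nlinarith
      have : T n * (p - 1) < 1 := (mul_lt_mul_of_pos_left this h2).trans_eq h1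
      rw [sub_pos, lt_div_iff₀ (by linarith)]
      linarith) (fun n => by
      have hn : (0 : ℝ) ≤ n := n.cast_nonneg
      have hA' : (0 : ℝ) < (4 * n + 1) * u - 1 := by nlinarith
      have hB' : (0 : ℝ) < p * ((4 * n + 3) * v) - T (n + 1) - 1 := by
        have : (3 : ℝ) ≤ (4 * n + 3) * v := by nlinarith
        nlinarith [hT1 (n + 1)]
      simp only [blockEval, List.ofFn_succ, List.ofFn_zero, List.foldr_cons, List.foldr_nil]
      simp only [Matrix.cons_val, Fin.succ_zero_eq_one, Fin.succ_one_eq_two]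
      push_cast
      rw [four_step_eval hp0 (by linarith [hT0 (n + 1)]) (by linarith [hT1 (n + 1)]) hB' (hST n),
        two_step_eval (by linarith) hA' (hS1 n) (hTS n)])
  have e : 1 / (((p - 1 : ℤ) : ℝ) + (p / (1 + T 0) - (p - 1))) =
      (1 + besselRatio (1 / 2) y / (2 * p * u)) / p := by
    push_cast
    rw [add_sub_cancel, one_div_div]
    simp [hT, hρ]
  rw [← e]
  exact hX

theorem hasValue_exp {p u v : ℤ}
    (hq : ∀ i, 0 < (Stream'.cons (p - 1) (overlined fun n : ℕ =>
        ![1, (4 * n + 1) * u - 1, p - 1, 1, 2 * v - 1, p,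
          (4 * n + 3) * u - 1, 1, p - 1, 2 * v - 1, 1, p - 2])).get i) :
    HasValue 0 (Stream'.cons (p - 1) (overlined fun n : ℕ =>
        ![1, (4 * n + 1) * u - 1, p - 1, 1, 2 * v - 1, p,
          (4 * n + 3) * u - 1, 1, p - 1, 2 * v - 1, 1, p - 2]))
      (1 / (p : ℝ) + v * (1 - Real.exp (-1 / (u * (p : ℝ) ^ 2 * v)))) := by
  obtain ⟨hc, hf⟩ := forall_pos_of_cons_overlined hq
  have hp : 2 < p := by have := hf 0 11; simp at this; linarith
  have hu : 1 < u := by have := hf 0 1; simp at this; linarith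
  have hv : 0 < v := by have := hf 0 4; simp at this; linarith
  have hp' : (2 : ℝ) < p := by exact_mod_cast hp
  have hp0 : (0 : ℝ) < p := by linarith
  have hu' : (2 : ℝ) ≤ u := by exact_mod_cast hu
  have hv' : (1 : ℝ) ≤ v := by exact_mod_cast hv
  have hu0 : (0 : ℝ) < u := by linarith
  have hv0 : (0 : ℝ) < v := by linarith
  set w : ℝ := 1 / (u * (p : ℝ) ^ 2 * v) with hw
  have hw0 : 0 < w := by positivity
  -- Scaled so that `t 0 = tanh (w / 2)`.
  set t : ℕ → ℝ := fun k => w / 4 * besselRatio (1 / 2 + k) ((w / 2) ^ 2 / 4) with ht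
  have hy0 : 0 ≤ (w / 2) ^ 2 / 4 := by positivity
  have hν : ∀ k : ℕ, (0 : ℝ) < 1 / 2 + k := fun k => by positivity
  have ht0 : ∀ k, 0 < t k := fun k => mul_pos (by positivity) (besselRatio_pos (hν k) hy0)
  have hts : ∀ k : ℕ, t k * (2 * p * ((2 * k + 1) * u) * (p * v) + t (k + 1)) = 1 := fun k => by
    have r := besselRatio_mul_of_nonneg (hν k) hy0
    simp only [ht]
    push_cast
    rw [← add_assoc (1 / 2 : ℝ)]
    refine Eq.trans ?_ r
    rw [hw]
    field_simp
    ring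
  have hts₀ : ∀ n : ℕ, t (2 * n) * (2 * p * ((4 * n + 1) * u) * (p * v) + t (2 * n + 1)) = 1 :=
    fun n => by
      have r := hts (2 * n)
      push_cast at r
      refine Eq.trans ?_ r; ring
  have hts₁ : ∀ n : ℕ,
      t (2 * n + 1) * (2 * p * ((4 * n + 3) * u) * (p * v) + t (2 * (n + 1))) = 1 :=
    fun n => by
      have r := hts (2 * n + 1)
      push_cast at r
      rw [show 2 * (n + 1) = 2 * n + 1 + 1 by ring]
      refine Eq.trans ?_ r; ring
  have htV : ∀ k : ℕ, 2 * p * v * t k * p < 1 := fun k => by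
    have r := hts k
    have h0 := ht0 k
    have h1 := ht0 (k + 1)
    have hk : (1 : ℝ) ≤ (2 * k + 1) * u := by nlinarith [(k.cast_nonneg : (0 : ℝ) ≤ k)]
    have : 2 * p * v * t k * p * 1 ≤ 2 * p * v * t k * p * ((2 * k + 1) * u) :=
      mul_le_mul_of_nonneg_left hk (by positivity)
    nlinarith [mul_pos h0 h1]
  have htV1 : ∀ k : ℕ, 2 * p * v * t k < 1 := fun k => by
    have h0 := ht0 k
    have : 0 < 2 * p * v * t k := by positivity
    nlinarith [htV k]
  set T : ℕ → ℝ := fun n => 2 * p * v * t (2 * n) / (1 + t (2 * n)) with hT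
  have hT0 : ∀ n, 0 < T n := fun n => by
    have := ht0 (2 * n); simp only [hT]; positivity
  have hX := hasValue_cons_overlined (p - 1) _ (fun n => p / (1 + T n) - (p - 1)) hc hf
    (fun n => by
      have h0 := ht0 (2 * n)
      have : T n * p < 1 := by
        simp only [hT]
        rw [div_mul_eq_mul_div, div_lt_one (by linarith)]
        linarith [htV (2 * n)]
      rw [sub_pos, lt_div_iff₀ (by linarith [hT0 n])]
      linarith [hT0 n]) (fun n => by
      have hn : (0 : ℝ) ≤ n := n.cast_nonneg
      have hA : (0 : ℝ) < (4 * n + 1) * u - 1 := by nlinarith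
      have hC : (1 : ℝ) ≤ (4 * n + 3) * u := by nlinarith
      have h0 := ht0 (2 * n)
      have h1 := ht0 (2 * n + 1)
      have h2 := ht0 (2 * (n + 1))
      simp only [blockEval, List.ofFn_succ, List.ofFn_zero, List.foldr_cons, List.foldr_nil]
      simp only [Matrix.cons_val, Fin.succ_zero_eq_one, Fin.succ_one_eq_two]
      push_cast
      -- The block of twelve splits as `2 + 3 + 7`, evaluated from the right. With `s = t (2 * n +
      -- 1)`, the seven-step value carries `-2pvs / (1 + s)`; adding `2pv` gives `2pv / (1 + s)`,
      -- whose reciprocal is the middle `T`.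
      rw [seven_step_eval hp' hC hv' h1 h2 (htV1 _) (hts₁ n),
        three_step_eval (T := (1 + t (2 * n + 1)) / (2 * p * v)) (by linarith) (by linarith) ?_ ?_,
        two_step_eval (T := T n) (by linarith) hA (by positivity) ?_]
      · have r := hts₀ n
        simp only [hT]
        field_simp
        linear_combination r
      · have : 2 * p * v * t (2 * n + 1) / (1 + t (2 * n + 1)) < 1 := by
          rw [div_lt_one (by linarith)]
          linarith [htV1 (2 * n + 1)]
        linarith
      · field_simp
        ring)
  have e : 1 / (((p - 1 : ℤ) : ℝ) + (p / (1 + T 0) - (p - 1))) =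
      1 / (p : ℝ) + v * (1 - Real.exp (-1 / (u * (p : ℝ) ^ 2 * v))) := by
    have h0 := ht0 0
    have ht0' : t 0 = Real.tanh (w / 2) := by
      rw [tanh_eq_besselRatio]
      simp only [ht, Nat.cast_zero, add_zero]
      ring
    push_cast
    rw [neg_div, ← hw, one_sub_exp_neg_eq_tanh, ← ht0', add_sub_cancel, one_div_div]
    simp only [hT, mul_zero]
    field_simp
  rw [← e]
  exact hX

theorem sqrt_div_mul_one_div {u v : ℝ} (hu : 0 < u) (hv : 0 < v) :
    √(v / u) * (1 / √(u * v)) = 1 / u := by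
  rw [Real.sqrt_div hv.le, Real.sqrt_mul hu.le]
  have h₁ := Real.sqrt_pos.2 hu
  have h₂ := Real.sqrt_pos.2 hv
  have h₃ := Real.mul_self_sqrt hu.le
  field_simp
  nlinarith

theorem mainTheorem3 :
    (∀ a b p u v : ℤ, 0 < b →
      ∀ q : Stream' ℤ, q = (overlined fun n : ℕ =>
        ![p - 1, 1, u * (a + 2 * n * b) - 1, p - 1, 1, v * (a + (2 * n + 1) * b) - 1]) →
      (∀ i, 0 < q.get i) →
        HasValue 0 q
          (1 / (p : ℝ) + 1 / (p : ℝ) * √((v : ℝ) / u) *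
            (besselI ((a : ℝ) / b) (2 / (b * p * √((u : ℝ) * v))) /
              besselI ((a : ℝ) / b - 1) (2 / (b * p * √((u : ℝ) * v)))))) ∧
    (∀ p u v : ℤ,
      ∀ q : Stream' ℤ, q = Stream'.cons (p - 1) (overlined fun n : ℕ =>
        ![1, (4 * n + 1) * u - 1, p, (4 * n + 3) * v - 1, 1, p - 2]) →
      (∀ i, 0 < q.get i) →
        HasValue 0 q
          (1 / (p : ℝ) + 1 / (p : ℝ) * √((v : ℝ) / u) *
            Real.tan (1 / (p * √((u : ℝ) * v))))) ∧
    (∀ p u v : ℤ,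
      ∀ q : Stream' ℤ, q = (overlined fun n : ℕ =>
        ![p - 1, 1, (4 * n + 1) * u - 1, p - 1, 1, (4 * n + 3) * v - 1]) →
      (∀ i, 0 < q.get i) →
        HasValue 0 q
          (1 / (p : ℝ) + 1 / (p : ℝ) * √((v : ℝ) / u) *
            Real.tanh (1 / (p * √((u : ℝ) * v))))) ∧
    (∀ p u v : ℤ,
      ∀ q : Stream' ℤ, q = Stream'.cons (p - 1) (overlined fun n : ℕ =>
        ![1, (4 * n + 1) * u - 1, p - 1, 1, 2 * v - 1, p,
          (4 * n + 3) * u - 1, 1, p - 1, 2 * v - 1, 1, p - 2]) →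
      (∀ i, 0 < q.get i) →
        HasValue 0 q
          (1 / (p : ℝ) + v * (1 - Real.exp (-1 / (u * (p : ℝ) ^ 2 * v))))) := by
  refine ⟨?_, ?_, ?_, fun p u v q hq hpos => by subst hq; exact hasValue_exp hpos⟩
  · intro a b p u v hb q hq hpos
    subst hq
    obtain ⟨hp, hu, hv, h⟩ := hasValue_besselRatio hb hpos
    have hb' : (0 : ℝ) < b := by exact_mod_cast hb
    have hp' : (0 : ℝ) < p := by exact_mod_cast zero_lt_one.trans hp
    have hu' : (0 : ℝ) < u := by exact_mod_cast hu
    have hv' : (0 : ℝ) < v := by exact_mod_cast hv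
    have hs : 0 < √((u : ℝ) * v) := Real.sqrt_pos.2 (by positivity)
    convert h using 1
    have hy : (2 / (b * p * √((u : ℝ) * v))) ^ 2 / 4 = 1 / ((b : ℝ) ^ 2 * p ^ 2 * u * v) := by
      rw [div_pow, mul_pow, mul_pow, Real.sq_sqrt (by positivity)]
      field_simp
      norm_num
    rw [besselI_div_besselI _ (by positivity), hy]
    have key := sqrt_div_mul_one_div hu' hv'
    generalize besselRatio _ _ = R
    calc _ = 1 / (p : ℝ) + 1 / p * (√((v : ℝ) / u) * (1 / √((u : ℝ) * v))) *
          (R / (b * p)) := by field_simp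
      _ = _ := by rw [key]; field_simp
  · intro p u v q hq hpos
    subst hq
    obtain ⟨hp, hu, hv, h⟩ := hasValue_besselRatio_neg hpos
    have hp' : (0 : ℝ) < p := by exact_mod_cast zero_lt_two.trans hp
    have hu' : (0 : ℝ) < u := by exact_mod_cast zero_lt_one.trans hu
    have hv' : (0 : ℝ) < v := by exact_mod_cast hv
    have hs : 0 < √((u : ℝ) * v) := Real.sqrt_pos.2 (by positivity)
    convert h using 1
    have hy : (1 / (p * √((u : ℝ) * v))) ^ 2 / 4 = 1 / (4 * (p : ℝ) ^ 2 * u * v) := by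
      rw [div_pow, mul_pow, Real.sq_sqrt (by positivity)]
      field_simp
    rw [tan_eq_besselRatio, hy]
    have key := sqrt_div_mul_one_div hu' hv'
    generalize besselRatio _ _ = R
    calc _ = 1 / (p : ℝ) + 1 / p * (√((v : ℝ) / u) * (1 / √((u : ℝ) * v))) *
          (R / (2 * p)) := by field_simp
      _ = _ := by rw [key]; field_simp
  · intro p u v q hq hpos
    -- The `tanh` expansion is the Bessel one with `a = 1`, `b = 2`, that is, order `1/2`.
    have e : q = overlined fun n : ℕ =>
        ![p - 1, 1, u * (1 + 2 * n * 2) - 1, p - 1, 1, v * (1 + (2 * n + 1) * 2) - 1] := by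
      rw [hq]
      congr 1
      funext n
      rw [show (4 * n + 1) * u - 1 = u * (1 + 2 * n * 2) - 1 by ring,
        show (4 * n + 3) * v - 1 = v * (1 + (2 * n + 1) * 2) - 1 by ring]
    subst e
    obtain ⟨hp, hu, hv, h⟩ := hasValue_besselRatio zero_lt_two hpos
    have hp' : (0 : ℝ) < p := by exact_mod_cast zero_lt_one.trans hp
    have hu' : (0 : ℝ) < u := by exact_mod_cast hu
    have hv' : (0 : ℝ) < v := by exact_mod_cast hv
    have hs : 0 < √((u : ℝ) * v) := Real.sqrt_pos.2 (by positivity)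
    convert h using 1
    have hy : (1 / (p * √((u : ℝ) * v))) ^ 2 / 4 =
        1 / (((2 : ℤ) : ℝ) ^ 2 * (p : ℝ) ^ 2 * u * v) := by
      rw [div_pow, mul_pow, Real.sq_sqrt (by positivity)]
      push_cast
      field_simp
      norm_num
    rw [tanh_eq_besselRatio, hy]
    push_cast
    have key := sqrt_div_mul_one_div hu' hv'
    generalize besselRatio _ _ = R
    calc _ = 1 / (p : ℝ) + 1 / p * (√((v : ℝ) / u) * (1 / √((u : ℝ) * v))) *
          (R / (2 * p)) := by field_simp
      _ = _ := by rw [key]; field_simp
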